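/- For a finite connected simple graph $H$ with at least one edge, let $\mathscr{K}(H)$ denote Kemeny's constant of the simple random walk on $H$, i.e. $\mathscr{K}(H)=\sum_{j}\pi_j m_{ij}$, where $\pi$ is the unique stationary distribution of the walk and $m_{ij}$ is the expected hitting time of $j$ from $i$ (with $m_{jj}=0$); all $m_{ij}$ are finite and the sum does not depend on the starting vertex $i$. Let $G$ be a finite connected simple graph and let $v$ be a vertex of $G$. Attach three new pendant vertices $a,b,c$ to $v$ (each joined to $v$ only). Let $\widetilde G$ be the graph obtained from this graph by adding the edge $ab$, and let $\widehat G$ be obtained from $\widetilde G$ by adding the edge $bc$. Theorem. If $|E(G)|\ge 4$, then $\mathscr{K}(\widehat G)>\mathscr{K}(\widetilde G)$. The bound $4$ cannot be lowered to $3$: if $G=S_4$ is the star on $4$ vertices (so $|E(G)|=3$) and $v$ is its centre, then $\mathscr{K}(\widehat G)<\mathscr{K}(\widetilde G)$. -/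

import Mathlib

/-- The transition matrix of the simple random walk on a finite graph: from `i` the walk moves to
each neighbour of `i` with probability `1 / deg i`. -/
noncomputable def SimpleGraph.walkMatrix {V : Type*} [Fintype V] (G : SimpleGraph V) :
    Matrix V V ℝ :=
  open Classical in
  Matrix.of fun i j => if G.Adj i j then (G.degree i : ℝ)⁻¹ else 0

/-- `π` is a stationary distribution of the Markov chain with transition matrix `P`. -/
def IsStationaryDistribution {V : Type*} [Fintype V] (P : Matrix V V ℝ) (π : V → ℝ) : Prop :=
  π ∈ stdSimplex ℝ V ∧ Matrix.vecMul π P = π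

/-- The probability that the Markov chain with transition matrix `P` started at `i` visits `j` for
the first time at time `t` (time `0` counts, so that `j` is hit at time `0` from `i = j`): the sum,
over all trajectories `x 0, …, x t` with `x 0 = i` and `x t = j` that avoid `j` before time `t`,
of the probability of the trajectory. -/
noncomputable def firstHitProb {V : Type*} [Fintype V] (P : Matrix V V ℝ) (i j : V) (t : ℕ) : ℝ :=
  open Classical in
  ∑ x : Fin (t + 1) → V with
      x 0 = i ∧ x (Fin.last t) = j ∧ ∀ s : Fin t, x s.castSucc ≠ j,
    ∏ s : Fin t, P (x s.castSucc) (x s.succ)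

/-- `h` is the expected hitting time of `j` from `i`: the hitting time is almost surely finite and
its expectation converges to `h`. -/
def IsMeanHittingTime {V : Type*} [Fintype V] (P : Matrix V V ℝ) (i j : V) (h : ℝ) : Prop :=
  HasSum (fun t : ℕ => firstHitProb P i j t) 1 ∧
    HasSum (fun t : ℕ => (t : ℝ) * firstHitProb P i j t) h

/-- `κ` is Kemeny's constant of the simple random walk on `G`: the walk has a unique stationary
distribution `π`, all mean hitting times `m i j` exist, and `∑ j, π j * m i j` equals `κ` for every
starting vertex `i`. -/
def SimpleGraph.HasKemenyConstant {V : Type*} [Fintype V] (G : SimpleGraph V) (κ : ℝ) : Prop :=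
  ∃ (π : V → ℝ) (m : V → V → ℝ),
    (∀ π' : V → ℝ, IsStationaryDistribution G.walkMatrix π' ↔ π' = π) ∧
    (∀ i j, IsMeanHittingTime G.walkMatrix i j (m i j)) ∧
    ∀ i, ∑ j, π j * m i j = κ

/-- The graph obtained from `G` by attaching three pendant vertices `a = Sum.inr 0`,
`b = Sum.inr 1`, `c = Sum.inr 2` at the vertex `v`. -/
def SimpleGraph.pendantTriplet {V : Type*} (G : SimpleGraph V) (v : V) :
    SimpleGraph (V ⊕ Fin 3) :=
  G.map Function.Embedding.inl ⊔
    SimpleGraph.fromEdgeSet (Set.range fun k : Fin 3 => s(Sum.inl v, Sum.inr k))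

/-- Three pendants `a`, `b`, `c` at `v`, together with the edge `ab`. -/
def SimpleGraph.pendantTripletOne {V : Type*} (G : SimpleGraph V) (v : V) :
    SimpleGraph (V ⊕ Fin 3) :=
  G.pendantTriplet v ⊔ SimpleGraph.edge (Sum.inr 0) (Sum.inr 1)

/-- Three pendants `a`, `b`, `c` at `v`, together with the edges `ab` and `bc`. -/
def SimpleGraph.pendantTripletTwo {V : Type*} (G : SimpleGraph V) (v : V) :
    SimpleGraph (V ⊕ Fin 3) :=
  G.pendantTripletOne v ⊔ SimpleGraph.edge (Sum.inr 1) (Sum.inr 2)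

/-! Grounding the Laplacian at `v` reduces the comparison to two numbers attached to `G`. If `Γ` is
the Green kernel grounded at `v` and `d` the degree vector, Kemeny's constant is `∑ d_j Γ_jj - (dᵀ Γ
d) / ∑ d_j` (`IsGreenKernel.hasKemenyConstant`). Since `v` is a cut vertex of the enlarged graphs,
their kernels are block diagonal (`IsConeGluing.isGreenKernel`): one block is that of `G`, the other
is `(L_B + 1)⁻¹` for the graph `B` on the three new vertices.

In the difference of the two constants the trace term of `G` cancels, leaving only `m = |E(G)|` and
`s = dᵀ Γ d`. Its sign is that of `2/3 (m + 4)(m + 5) + s - 15/2 m - 21`. Here `s` is the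
degree-weighted sum of the hitting times of `v`; each vertex other than `v` has hitting time at
least 1, so `s ≥ 2m - deg v ≥ m` (`ncard_edgeSet_le`), which suffices for `m ≥ 4`. A star centred at
`v` has `s = m`, and for `m = 3` the sign is negative. -/

/-! ### First-step analysis of hitting probabilities -/

open Classical in
theorem firstHitProb_zero {V : Type*} [Fintype V] (P : Matrix V V ℝ) (i j : V) :
    firstHitProb P i j 0 = if i = j then 1 else 0 := by
  unfold firstHitProb
  rw [Finset.sum_filter, ← (Equiv.funUnique (Fin 1) V).symm.sum_comp]
  by_cases hij : i = j
  · subst hij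
    simp [uniqueElim_const]
  · rw [if_neg hij]
    refine Finset.sum_eq_zero fun x _ => if_neg ?_
    rintro ⟨h₀, h₁, -⟩
    exact hij (h₀.symm.trans h₁)

theorem Fintype.sum_fin_succ_fun {V M : Type*} [Fintype V] [AddCommMonoid M] {n : ℕ}
    (f : (Fin (n + 1) → V) → M) :
    ∑ x, f x = ∑ a : V, ∑ y : Fin n → V, f (Fin.cons a y : Fin (n + 1) → V) := by
  rw [← (Fin.consEquiv fun _ : Fin (n + 1) => V).sum_comp, Fintype.sum_prod_type]
  rfl

-- Condition on the first step: a trajectory is split into its initial state and its tail, and the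
-- tail is a first-hit trajectory from its own starting state.
open Classical in
theorem firstHitProb_succ {V : Type*} [Fintype V] (P : Matrix V V ℝ) (i j : V)
    (t : ℕ) : firstHitProb P i j (t + 1) =
      if i = j then 0 else ∑ k, P i k * firstHitProb P k j t := by
  unfold firstHitProb
  simp only [Finset.sum_filter]
  rw [Fintype.sum_fin_succ_fun]
  have hcons : ∀ (a : V) (y : Fin (t + 1) → V),
      (if (Fin.cons a y : Fin (t + 2) → V) 0 = i ∧
          (Fin.cons a y : Fin (t + 2) → V) (Fin.last (t + 1)) = j ∧
          ∀ s : Fin (t + 1), (Fin.cons a y : Fin (t + 2) → V) s.castSucc ≠ j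
        then ∏ s : Fin (t + 1), P ((Fin.cons a y : Fin (t + 2) → V) s.castSucc)
          ((Fin.cons a y : Fin (t + 2) → V) s.succ) else 0) =
      if a = i then if i = j then 0 else P i (y 0) *
        (if y (Fin.last t) = j ∧ ∀ s : Fin t, y s.castSucc ≠ j
          then ∏ s : Fin t, P (y s.castSucc) (y s.succ) else 0) else 0 := by
    intro a y
    simp only [Fin.cons_zero, ← Fin.succ_last, Fin.cons_succ,
      Fin.forall_fin_succ, Fin.castSucc_zero, ← Fin.succ_castSucc, Fin.prod_univ_succ]
    by_cases ha : a = i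
    · subst ha
      by_cases hj : a = j
      · simp [hj]
      · simp [hj]
    · simp [ha]
  simp only [hcons]
  rw [Finset.sum_comm]
  by_cases hij : i = j
  · simp [hij]
  · simp only [hij, if_false, Finset.sum_ite_eq', Finset.mem_univ, if_true, Finset.mul_sum]
    rw [Finset.sum_comm]
    refine Finset.sum_congr rfl fun y _ => ?_
    rw [Finset.sum_eq_single (y 0)]
    · simp
    · intro b _ hb
      simp [hb.symm]
    · simp

/-! ### Mean hitting times from the hitting-time equations -/

open Filter Topology

/-- Olivier's theorem: the terms of a convergent antitone series of real numbers are `o(1 / n)`. -/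
theorem Antitone.tendsto_natCast_mul_of_summable {u : ℕ → ℝ} (hu : Antitone u)
    (hs : Summable u) : Tendsto (fun n : ℕ => (n : ℝ) * u n) atTop (𝓝 0) := by
  have h₀ : ∀ n, 0 ≤ u n := fun n => hu.le_of_tendsto hs.tendsto_atTop_zero n
  have hpart : Tendsto (fun n => ∑ k ∈ Finset.range n, u k) atTop (𝓝 (∑' k, u k)) :=
    hs.hasSum.tendsto_sum_nat
  have hhalf : Tendsto (fun n : ℕ => n / 2) atTop atTop :=
    tendsto_atTop.2 fun b => eventually_atTop.2 ⟨2 * b, fun n hn => by omega⟩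
  have hlim : Tendsto (fun n => 2 * (∑ k ∈ Finset.range n, u k -
      ∑ k ∈ Finset.range (n / 2), u k)) atTop (𝓝 0) := by
    simpa using (hpart.sub (hpart.comp hhalf)).const_mul 2
  refine squeeze_zero (fun n => mul_nonneg n.cast_nonneg (h₀ n)) (fun n => ?_) hlim
  have hle : n / 2 ≤ n := Nat.div_le_self n 2
  rw [← Finset.sum_Ico_eq_sub _ hle]
  -- At least half of the `n` copies of `u n` are dominated by a block of the series that tends to
  -- 0.
  have hcard : (n - n / 2 : ℕ) • u n ≤ ∑ k ∈ Finset.Ico (n / 2) n, u k := by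
    rw [← Nat.card_Ico]
    exact Finset.card_nsmul_le_sum _ _ _ fun k hk => hu (Finset.mem_Ico.1 hk).2.le
  have hn : (n : ℝ) ≤ 2 * ((n - n / 2 : ℕ) : ℝ) := by
    have : n ≤ 2 * (n - n / 2) := by omega
    exact_mod_cast this
  rw [nsmul_eq_mul] at hcard
  nlinarith [mul_le_mul_of_nonneg_right hn (h₀ n)]

/-- The probability that the chain started at `i` has not visited `j` up to time `n`. -/
noncomputable def survivalProb {V : Type*} [Fintype V] (P : Matrix V V ℝ) (i j : V) (n : ℕ) : ℝ :=
  1 - ∑ t ∈ Finset.range (n + 1), firstHitProb P i j t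

open Classical in
theorem survivalProb_zero {V : Type*} [Fintype V] (P : Matrix V V ℝ) (i j : V) :
    survivalProb P i j 0 = if i = j then 0 else 1 := by
  rw [survivalProb, zero_add, Finset.sum_range_one, firstHitProb_zero]
  split_ifs <;> simp

open Classical in
theorem survivalProb_succ {V : Type*} [Fintype V] {P : Matrix V V ℝ} (hP : ∀ i, ∑ k, P i k = 1)
    (i j : V) (n : ℕ) : survivalProb P i j (n + 1) =
      if i = j then 0 else ∑ k, P i k * survivalProb P k j n := by
  rw [survivalProb, Finset.sum_range_succ', firstHitProb_zero]
  simp only [firstHitProb_succ, survivalProb]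
  split_ifs with h
  · simp
  · simp only [mul_sub, Finset.sum_sub_distrib, mul_one, hP, add_zero, Finset.mul_sum]
    rw [Finset.sum_comm]

theorem survivalProb_self {V : Type*} [Fintype V] {P : Matrix V V ℝ} (hP : ∀ i, ∑ k, P i k = 1)
    (j : V) (n : ℕ) : survivalProb P j j n = 0 := by
  cases n with
  | zero => simp [survivalProb_zero]
  | succ n => simp [survivalProb_succ hP]

theorem survivalProb_nonneg {V : Type*} [Fintype V] {P : Matrix V V ℝ}
    (hP : ∀ i, ∑ k, P i k = 1) (hP₀ : ∀ i k, 0 ≤ P i k) (i j : V) (n : ℕ) :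
    0 ≤ survivalProb P i j n := by
  induction n generalizing i with
  | zero => rw [survivalProb_zero]; split_ifs <;> norm_num
  | succ n ih =>
    rw [survivalProb_succ hP]
    split_ifs
    · exact le_rfl
    · exact Finset.sum_nonneg fun k _ => mul_nonneg (hP₀ i k) (ih k)

theorem firstHitProb_nonneg {V : Type*} [Fintype V] {P : Matrix V V ℝ}
    (hP₀ : ∀ i k, 0 ≤ P i k) (i j : V) (n : ℕ) : 0 ≤ firstHitProb P i j n :=
  Finset.sum_nonneg fun _ _ => Finset.prod_nonneg fun _ _ => hP₀ _ _

/-- A nonnegative solution of the hitting-time equations for `j` is the mean hitting time. -/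
theorem isMeanHittingTime_of_nonneg {V : Type*} [Fintype V] {P : Matrix V V ℝ}
    (hP : ∀ i, ∑ k, P i k = 1) (hP₀ : ∀ i k, 0 ≤ P i k) {j : V} {h : V → ℝ} (h₀ : ∀ i, 0 ≤ h i)
    (hj : h j = 0) (heq : ∀ i, i ≠ j → h i = 1 + ∑ k, P i k * h k) (i : V) :
    IsMeanHittingTime P i j (h i) := by
  set u := fun (i : V) n => survivalProb P i j n with hu
  have hu₀ : ∀ i n, 0 ≤ u i n := fun i n => survivalProb_nonneg hP hP₀ i j n
  obtain ⟨C, hC⟩ : ∃ C, ∀ i, h i ≤ C := by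
    obtain ⟨C, hC⟩ := (Set.finite_range h).bddAbove
    exact ⟨C, fun i => hC ⟨i, rfl⟩⟩
  -- Iterating the equation `n` times leaves, beyond the partial sum of survival probabilities, the
  -- mean of `h` over walks that have not yet hit `j`; this remainder lies between 0 and `C * u i
  -- n`.
  have key : ∀ n i, ∑ s ∈ Finset.range n, u i s ≤ h i ∧
      h i ≤ ∑ s ∈ Finset.range n, u i s + C * u i n := by
    intro n
    induction n with
    | zero =>
      intro i
      simp only [hu, Finset.range_zero, Finset.sum_empty, survivalProb_zero, zero_add]
      refine ⟨h₀ i, ?_⟩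
      split_ifs with hi
      · simp [hi, hj]
      · simpa using hC i
    | succ n ih =>
      intro i
      by_cases hi : i = j
      · subst hi
        simp [hu, survivalProb_self hP, hj]
      · rw [heq i hi, Finset.sum_range_succ']
        simp only [hu, survivalProb_succ hP, survivalProb_zero, if_neg hi]
        rw [Finset.sum_comm, Finset.mul_sum]
        simp only [← Finset.mul_sum]
        constructor
        · rw [add_comm]
          gcongr with k
          · exact hP₀ i k
          · exact (ih k).1
        · rw [add_comm _ (1 : ℝ), add_assoc, Finset.mul_sum _ _ C, ← Finset.sum_add_distrib]
          gcongr with k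
          calc P i k * h k ≤ P i k * (∑ s ∈ Finset.range n, u k s + C * u k n) :=
                mul_le_mul_of_nonneg_left (ih k).2 (hP₀ i k)
            _ = _ := by simp only [hu]; ring
  have hsum : Summable (u i) :=
    summable_of_sum_range_le (hu₀ i) fun n => (key n i).1
  have hu_lim : Tendsto (u i) atTop (𝓝 0) := hsum.tendsto_atTop_zero
  have hpart : Tendsto (fun n => ∑ s ∈ Finset.range n, u i s) atTop (𝓝 (h i)) := by
    refine tendsto_of_tendsto_of_tendsto_of_le_of_le (g := fun n => h i - C * u i n) ?_
      tendsto_const_nhds (fun n => ?_) fun n => (key n i).1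
    · simpa using tendsto_const_nhds.sub (hu_lim.const_mul C)
    · linarith [(key n i).2]
  have hstep : ∀ n, firstHitProb P i j (n + 1) = u i n - u i (n + 1) := fun n => by
    simp only [hu, survivalProb, Finset.sum_range_succ _ (n + 1)]
    ring
  have hanti : Antitone (u i) := antitone_nat_of_succ_le fun n => by
    linarith [hstep n, firstHitProb_nonneg hP₀ i j (n + 1)]
  constructor
  · rw [hasSum_iff_tendsto_nat_of_nonneg fun n => firstHitProb_nonneg hP₀ i j n,
      ← tendsto_add_atTop_iff_nat 1]
    have : Tendsto (fun n => 1 - u i n) atTop (𝓝 1) := by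
      simpa using tendsto_const_nhds.sub hu_lim
    exact this.congr fun n => by simp [hu, survivalProb]
  · rw [hasSum_iff_tendsto_nat_of_nonneg fun n =>
        mul_nonneg n.cast_nonneg (firstHitProb_nonneg hP₀ i j n),
      ← tendsto_add_atTop_iff_nat 1]
    -- Summation by parts: the partial sum of `t * firstHitProb` through `t = n` is `∑_{s < n} u_s -
    -- n u_n`, and the boundary term vanishes by Olivier's theorem.
    have hlim := hpart.sub (hanti.tendsto_natCast_mul_of_summable hsum)
    rw [sub_zero] at hlim
    refine hlim.congr fun n => ?_
    induction n with
    | zero => simp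
    | succ n ih =>
      rw [Finset.sum_range_succ _ (n + 1), ← ih, hstep, Finset.sum_range_succ]
      push_cast
      ring

/-! ### The graph Laplacian -/

open Classical in
/-- The Laplacian of a finite graph as a linear map on functions. -/
noncomputable def SimpleGraph.laplacian {V : Type*} [Fintype V] (G : SimpleGraph V) :
    (V → ℝ) →ₗ[ℝ] V → ℝ :=
  Matrix.toLin' (G.lapMatrix ℝ)

open Classical in
theorem SimpleGraph.sum_adj_eq_degree {V : Type*} [Fintype V] (G : SimpleGraph V) (i : V) :
    ∑ j, (if G.Adj i j then (1 : ℝ) else 0) = G.degree i :=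
  (G.degree_eq_sum_if_adj i).symm

open Classical in
theorem SimpleGraph.laplacian_apply {V : Type*} [Fintype V] (G : SimpleGraph V) (f : V → ℝ)
    (i : V) : G.laplacian f i = G.degree i * f i - ∑ j, if G.Adj i j then f j else 0 := by
  rw [laplacian, Matrix.toLin'_apply, lapMatrix_mulVec_apply, ← Finset.sum_filter,
    neighborFinset_eq_filter]

theorem SimpleGraph.laplacian_const {V : Type*} [Fintype V] (G : SimpleGraph V) (c : ℝ) :
    G.laplacian (fun _ => c) = 0 := by
  classical
  funext i
  simp only [laplacian_apply, ← sum_adj_eq_degree, Finset.sum_mul, ite_mul, one_mul, zero_mul,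
    sub_self, Pi.zero_apply]

theorem SimpleGraph.sum_laplacian_mul {V : Type*} [Fintype V] (G : SimpleGraph V) (f g : V → ℝ) :
    ∑ i, G.laplacian f i * g i = ∑ i, f i * G.laplacian g i := by
  classical
  simp only [laplacian_apply, sub_mul, mul_sub, Finset.sum_sub_distrib, Finset.sum_mul,
    Finset.mul_sum]
  rw [Finset.sum_comm (f := fun i j => (if G.Adj i j then f j else 0) * g i)]
  congr 1
  · exact Finset.sum_congr rfl fun i _ => by ring
  · refine Finset.sum_congr rfl fun i _ => Finset.sum_congr rfl fun j _ => ?_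
    rw [G.adj_comm]
    split_ifs <;> simp

theorem SimpleGraph.sum_laplacian {V : Type*} [Fintype V] (G : SimpleGraph V) (f : V → ℝ) :
    ∑ i, G.laplacian f i = 0 := by
  simpa [laplacian_const] using G.sum_laplacian_mul f fun _ => 1

theorem SimpleGraph.Connected.eq_of_laplacian_eq_zero {V : Type*} [Fintype V] {G : SimpleGraph V}
    (hG : G.Connected) {f : V → ℝ} (hf : G.laplacian f = 0) (i j : V) : f i = f j := by
  classical
  exact G.lapMatrix_mulVec_eq_zero_iff_forall_reachable.1 hf i j (hG.preconnected i j)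

/-- The minimum principle for functions with positive Laplacian off one vertex. -/
theorem SimpleGraph.nonneg_of_laplacian_pos {V : Type*} [Fintype V] (G : SimpleGraph V)
    {f : V → ℝ} {j : V} (hj : f j = 0) (hf : ∀ i, i ≠ j → 0 < G.laplacian f i) (i : V) :
    0 ≤ f i := by
  classical
  obtain ⟨a, -, ha⟩ := Finset.exists_min_image Finset.univ f ⟨j, Finset.mem_univ j⟩
  by_cases haj : a = j
  · exact (hj.symm.trans (by rw [haj])).le.trans (ha i (Finset.mem_univ i))
  · exfalso
    have h := hf a haj
    rw [laplacian_apply, ← sum_adj_eq_degree, Finset.sum_mul, ← Finset.sum_sub_distrib] at h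
    refine h.not_ge (Finset.sum_nonpos fun k _ => ?_)
    split_ifs
    · linarith [ha k (Finset.mem_univ k)]
    · simp

/-! ### Green kernels and Kemeny's constant -/

open Classical in
/-- `Γ` is the Green kernel of `G` grounded at `v`: the symmetric kernel vanishing at `v` that
inverts the Laplacian away from `v`. -/
structure SimpleGraph.IsGreenKernel {V : Type*} [Fintype V] (G : SimpleGraph V) (v : V)
    (Γ : V → V → ℝ) : Prop where
  symm : ∀ i k, Γ i k = Γ k i
  ground : ∀ i, Γ v i = 0
  laplacian : ∀ k i, G.laplacian (fun j => Γ j k) i =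
    (if i = k then 1 else 0) - if i = v then 1 else 0

/-- The rank-one perturbation `L + e_v e_vᵀ` is injective: summing the coordinates of a null
equation gives `f v = 0`, then `f` is harmonic, hence constant. Its inverse is symmetric and has
column `v` identically 1, so subtracting 1 from every entry grounds it at `v`. -/
theorem SimpleGraph.Connected.exists_isGreenKernel {V : Type*} [Fintype V] {G : SimpleGraph V}
    (hG : G.Connected) (v : V) : ∃ Γ, G.IsGreenKernel v Γ := by
  classical
  let T : (V → ℝ) →ₗ[ℝ] V → ℝ :=
    G.laplacian + (LinearMap.proj v).smulRight (Pi.single v (1 : ℝ))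
  have hT : ∀ f i, T f i = G.laplacian f i + f v * if i = v then 1 else 0 := fun f i => by
    simp [T, Pi.single_apply]
  have hinj : Function.Injective T := by
    rw [← LinearMap.ker_eq_bot, LinearMap.ker_eq_bot']
    intro f hf
    have hfi : ∀ i, G.laplacian f i + f v * (if i = v then 1 else 0) = 0 := fun i => by
      rw [← hT, hf, Pi.zero_apply]
    have hv : f v = 0 := by
      have h := Finset.sum_congr rfl fun i (_ : i ∈ Finset.univ) => hfi i
      simpa [Finset.sum_add_distrib, sum_laplacian] using h
    have h₀ : G.laplacian f = 0 := funext fun i => by simpa [hv] using hfi i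
    exact funext fun i => (hG.eq_of_laplacian_eq_zero h₀ i v).trans hv
  have hsurj : Function.Surjective T := LinearMap.injective_iff_surjective.1 hinj
  choose g hg using fun k => hsurj (Pi.single k (1 : ℝ))
  have hg' : ∀ k i, G.laplacian (g k) i + g k v * (if i = v then 1 else 0) =
      if i = k then 1 else 0 := fun k i => by rw [← hT, hg, Pi.single_apply]
  have hgv : g v = fun _ => 1 := hinj <| by
    rw [hg]
    funext i
    rw [hT, laplacian_const, Pi.single_apply]
    simp
  have hsymm : ∀ i k, g k i = g i k := by
    have hpair : ∀ i k, ∑ a, G.laplacian (g i) a * g k a = g k i - g i v * g k v := by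
      intro i k
      simp only [fun a => eq_sub_of_add_eq (hg' i a), sub_mul, Finset.sum_sub_distrib]
      simp
    intro i k
    have h := G.sum_laplacian_mul (g i) (g k)
    simp only [mul_comm (g i _), hpair] at h
    linarith [mul_comm (g i v) (g k v)]
  refine ⟨fun i k => g k i - 1, fun i k => by rw [hsymm], fun i => ?_, fun k i => ?_⟩
  · rw [hsymm, hgv, sub_self]
  · have hsub : (fun j => g k j - 1) = g k - fun _ => 1 := rfl
    have hkv : g k v = 1 := by rw [hsymm, hgv]
    rw [hsub, map_sub, laplacian_const, sub_zero, eq_sub_of_add_eq (hg' k i), hkv, one_mul]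

open Classical in
theorem SimpleGraph.IsGreenKernel.laplacian_sum {V : Type*} [Fintype V] {G : SimpleGraph V}
    {v : V} {Γ : V → V → ℝ} (hΓ : G.IsGreenKernel v Γ) (c : V → ℝ) (i : V) :
    G.laplacian (fun j => ∑ k, c k * Γ j k) i = c i - (∑ k, c k) * if i = v then 1 else 0 := by
  have hsum : (fun j => ∑ k, c k * Γ j k) = ∑ k, c k • fun j => Γ j k := by
    funext j
    simp
  rw [hsum, map_sum, Finset.sum_apply]
  simp only [map_smul, Pi.smul_apply, hΓ.laplacian, smul_eq_mul, mul_sub, Finset.sum_sub_distrib,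
    Finset.sum_mul]
  simp

-- Stationarity of `π` says that `π / deg` is harmonic; pairing its Laplacian with the column `Γ ·
-- k` shows that its values at `k` and `v` agree.
open Classical in
theorem SimpleGraph.IsGreenKernel.isStationaryDistribution_iff {V : Type*} [Fintype V]
    {G : SimpleGraph V} {v : V} {Γ : V → V → ℝ} (hΓ : G.IsGreenKernel v Γ)
    (hd : ∀ i, 0 < G.degree i) (π : V → ℝ) :
    IsStationaryDistribution G.walkMatrix π ↔
      π = fun i => (G.degree i : ℝ) / ∑ k, (G.degree k : ℝ) := by
  have hd' : ∀ i, (0 : ℝ) < G.degree i := fun i => Nat.cast_pos.2 (hd i)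
  have hS : 0 < ∑ k, (G.degree k : ℝ) := Finset.sum_pos (fun i _ => hd' i) ⟨v, Finset.mem_univ v⟩
  have hvec : ∀ (π : V → ℝ) k, Matrix.vecMul π G.walkMatrix k =
      ∑ i, if G.Adj k i then π i / G.degree i else 0 := fun π k => by
    simp only [Matrix.vecMul, dotProduct, walkMatrix, Matrix.of_apply, G.adj_comm k, mul_ite,
      mul_zero, div_eq_mul_inv]
  constructor
  · rintro ⟨⟨-, hsum⟩, hstat⟩
    have hharm : G.laplacian (fun i => π i / G.degree i) = 0 := by
      funext k
      rw [laplacian_apply, ← hvec, hstat, mul_div_cancel₀ _ (hd' k).ne', sub_self, Pi.zero_apply]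
    have hconst : ∀ k, π k / G.degree k = π v / G.degree v := fun k => by
      have h := G.sum_laplacian_mul (fun i => π i / G.degree i) fun i => Γ i k
      simp only [hharm, hΓ.laplacian, mul_sub, Finset.sum_sub_distrib] at h
      simp only [Pi.zero_apply, zero_mul, Finset.sum_const_zero, mul_ite, mul_one, mul_zero,
        Finset.sum_ite_eq', Finset.mem_univ, if_true] at h
      linarith
    have hπ : ∀ k, π k = G.degree k * (π v / G.degree v) := fun k => by
      rw [← hconst k, mul_div_cancel₀ _ (hd' k).ne']
    have hc : (∑ k, (G.degree k : ℝ)) * (π v / G.degree v) = 1 := by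
      rw [Finset.sum_mul, ← hsum]
      exact Finset.sum_congr rfl fun k _ => (hπ k).symm
    funext k
    rw [hπ k, eq_div_iff hS.ne', mul_assoc, mul_comm (π v / _), hc, mul_one]
  · rintro rfl
    refine ⟨⟨fun i => (div_pos (hd' i) hS).le, ?_⟩, ?_⟩
    · rw [← Finset.sum_div, div_self hS.ne']
    · funext k
      rw [hvec, ← sum_adj_eq_degree, Finset.sum_div]
      refine Finset.sum_congr rfl fun i _ => ?_
      split_ifs
      · rw [div_right_comm, div_self (hd' i).ne']
      · rw [zero_div]

open Classical in
/-- Kemeny's constant in terms of the Green kernel grounded at an arbitrary vertex. -/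
theorem SimpleGraph.IsGreenKernel.hasKemenyConstant {V : Type*} [Fintype V]
    {G : SimpleGraph V} {v : V} {Γ : V → V → ℝ} (hΓ : G.IsGreenKernel v Γ)
    (hd : ∀ i, 0 < G.degree i) :
    G.HasKemenyConstant (∑ j, G.degree j * Γ j j -
      (∑ i, G.degree i * ∑ j, G.degree j * Γ i j) / ∑ k, (G.degree k : ℝ)) := by
  have hd' : ∀ i, (0 : ℝ) < G.degree i := fun i => Nat.cast_pos.2 (hd i)
  set S := ∑ k, (G.degree k : ℝ) with hS_def
  have hS : 0 < S := Finset.sum_pos (fun i _ => hd' i) ⟨v, Finset.mem_univ v⟩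
  set x : V → ℝ := fun i => ∑ k, G.degree k * Γ i k with hx
  -- Since `L x = deg - S e_v` and `L (Γ · j) = e_j - e_v`, the combination `x - S Γ · j` has
  -- Laplacian `deg - S e_j`; the constant makes it vanish at `j`.
  let m : V → V → ℝ := fun i j => S * (Γ j j - Γ i j) - x j + x i
  have hlap : ∀ j i, G.laplacian (fun i => m i j) i =
      G.degree i - S * if i = j then 1 else 0 := by
    intro j i
    have hm : (fun i => m i j) = (fun _ => S * Γ j j - x j) - S • (fun i => Γ i j) + x := by
      funext i
      simp only [m, Pi.add_apply, Pi.sub_apply, Pi.smul_apply, smul_eq_mul]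
      ring
    rw [hm, map_add, map_sub, laplacian_const, map_smul, Pi.add_apply, Pi.sub_apply,
      Pi.smul_apply, hΓ.laplacian, hx, hΓ.laplacian_sum fun k => (G.degree k : ℝ)]
    simp only [Pi.zero_apply, smul_eq_mul, ← hS_def]
    ring
  have hmj : ∀ j, m j j = 0 := fun j => by simp [m]
  have hlap_off : ∀ j i, i ≠ j → G.laplacian (fun i => m i j) i = G.degree i := fun j i hij => by
    rw [hlap, if_neg hij, mul_zero, sub_zero]
  refine ⟨_, m, hΓ.isStationaryDistribution_iff hd, fun i j => ?_, fun i => ?_⟩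
  · refine isMeanHittingTime_of_nonneg (h := fun i => m i j) (fun i => ?_) (fun i k => ?_)
      (G.nonneg_of_laplacian_pos (hmj j) fun i hij => ?_) (hmj j) (fun i hij => ?_) i
    · simp only [walkMatrix, Matrix.of_apply]
      have h := G.sum_adj_eq_degree i
      rw [← mul_inv_cancel₀ (hd' i).ne', ← h, Finset.sum_mul, h]
      exact Finset.sum_congr rfl fun k _ => by split_ifs <;> simp
    · simp only [walkMatrix, Matrix.of_apply]
      split_ifs
      · exact (inv_pos.2 (hd' i)).le
      · exact le_rfl
    · rw [hlap_off j i hij]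
      exact hd' i
    · have h := hlap_off j i hij
      rw [laplacian_apply] at h
      have hsum : ∑ k, G.walkMatrix i k * m k j =
          (G.degree i : ℝ)⁻¹ * ∑ k, if G.Adj i k then m k j else 0 := by
        rw [Finset.mul_sum]
        refine Finset.sum_congr rfl fun k _ => ?_
        simp only [walkMatrix, Matrix.of_apply]
        split_ifs <;> simp
      rw [hsum, ← sub_eq_iff_eq_add.2 (sub_eq_iff_eq_add'.1 h)]
      field_simp [(hd' i).ne']
      ring
  · have hsplit : ∀ j, (G.degree j : ℝ) / S * m i j =
        G.degree j * Γ j j - G.degree j * Γ i j - G.degree j * x j / S +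
          G.degree j / S * x i := fun j => by
      simp only [m]
      field_simp
    rw [Finset.sum_congr rfl fun j _ => hsplit j, Finset.sum_add_distrib, Finset.sum_sub_distrib,
      Finset.sum_sub_distrib, ← Finset.sum_div, ← Finset.sum_mul, ← Finset.sum_div, ← hS_def,
      div_self hS.ne']
    change _ - x i - _ + 1 * x i = _
    ring

/-! ### Cone gluings -/

/-- `H` is obtained from `G` by adding a disjoint copy of `B` and joining `v` to all of `B`. -/
structure SimpleGraph.IsConeGluing {V W : Type*} (G : SimpleGraph V) (v : V) (B : SimpleGraph W)
    (H : SimpleGraph (V ⊕ W)) : Prop where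
  inl_inl : ∀ i j, H.Adj (Sum.inl i) (Sum.inl j) ↔ G.Adj i j
  inl_inr : ∀ i w, H.Adj (Sum.inl i) (Sum.inr w) ↔ i = v
  inr_inr : ∀ u w, H.Adj (Sum.inr u) (Sum.inr w) ↔ B.Adj u w

section ConeGluing

variable {V W : Type*} [Fintype V] [Fintype W] {G : SimpleGraph V} {v : V} {B : SimpleGraph W}
  {H : SimpleGraph (V ⊕ W)}

open Classical in
theorem SimpleGraph.IsConeGluing.degree_inl (hH : G.IsConeGluing v B H) (i : V) :
    (H.degree (Sum.inl i) : ℝ) = G.degree i + Fintype.card W * if i = v then 1 else 0 := by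
  rw [← sum_adj_eq_degree, Fintype.sum_sum_type]
  simp only [hH.inl_inl, hH.inl_inr, sum_adj_eq_degree, Finset.sum_const, Finset.card_univ,
    nsmul_eq_mul]

open Classical in
theorem SimpleGraph.IsConeGluing.degree_inr (hH : G.IsConeGluing v B H) (w : W) :
    (H.degree (Sum.inr w) : ℝ) = 1 + B.degree w := by
  rw [← sum_adj_eq_degree, Fintype.sum_sum_type]
  simp only [hH.inr_inr, H.adj_comm (Sum.inr w) (Sum.inl _), hH.inl_inr, sum_adj_eq_degree,
    Finset.sum_ite_eq', Finset.mem_univ, if_true]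

theorem SimpleGraph.IsConeGluing.laplacian_inl (hH : G.IsConeGluing v B H) (f : V ⊕ W → ℝ)
    (i : V) [Decidable (i = v)] : H.laplacian f (Sum.inl i) = G.laplacian (fun j => f (Sum.inl j)) i +
      if i = v then ∑ w, (f (Sum.inl v) - f (Sum.inr w)) else 0 := by
  classical
  rw [laplacian_apply, laplacian_apply, hH.degree_inl, Fintype.sum_sum_type]
  simp only [hH.inl_inl, hH.inl_inr, Finset.sum_sub_distrib, Finset.sum_const, Finset.card_univ,
    nsmul_eq_mul]
  split_ifs with hi
  · subst hi
    ring
  · simp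

theorem SimpleGraph.IsConeGluing.laplacian_inr (hH : G.IsConeGluing v B H) (f : V ⊕ W → ℝ)
    (w : W) : H.laplacian f (Sum.inr w) = B.laplacian (fun u => f (Sum.inr u)) w +
      (f (Sum.inr w) - f (Sum.inl v)) := by
  classical
  rw [laplacian_apply, laplacian_apply, hH.degree_inr, Fintype.sum_sum_type]
  simp only [hH.inr_inr, H.adj_comm (Sum.inr w) (Sum.inl _), hH.inl_inr, Finset.sum_ite_eq',
    Finset.mem_univ, if_true]
  ring

open Classical in
/-- The Green kernel of a cone gluing is block diagonal. -/
theorem SimpleGraph.IsConeGluing.isGreenKernel (hH : G.IsConeGluing v B H) {Γ : V → V → ℝ}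
    (hΓ : G.IsGreenKernel v Γ) {C : W → W → ℝ} (hC : ∀ u w, C u w = C w u)
    (hC_lap : ∀ w u, B.laplacian (fun a => C a w) u + C u w = if u = w then 1 else 0) :
    H.IsGreenKernel (Sum.inl v)
      (Sum.elim (fun i => Sum.elim (Γ i) 0) fun w => Sum.elim 0 (C w)) where
  symm := by
    rintro (i | u) (j | w)
    exacts [hΓ.symm i j, rfl, rfl, hC u w]
  ground := by
    rintro (i | u)
    exacts [hΓ.ground i, rfl]
  laplacian := by
    rintro (k | w) (i | u)
    · simp only [hH.laplacian_inl, Sum.elim_inl, Sum.elim_inr, hΓ.laplacian, hΓ.ground,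
        Pi.zero_apply, Sum.inl.injEq]
      simp
    · simp only [hH.laplacian_inr, Sum.elim_inl, Sum.elim_inr, hΓ.ground, Pi.zero_apply,
        laplacian_const]
      simp
    · have hsum : ∑ u, C u w = 1 := by
        have h := Finset.sum_congr rfl fun u (_ : u ∈ Finset.univ) => hC_lap w u
        simpa [Finset.sum_add_distrib, sum_laplacian] using h
      simp only [hH.laplacian_inl, Sum.elim_inl, Sum.elim_inr, Pi.zero_apply, laplacian_const,
        zero_sub, Finset.sum_neg_distrib, hsum, Sum.inl.injEq]
      split_ifs <;> simp_all
    · simp only [hH.laplacian_inr, Sum.elim_inl, Sum.elim_inr, Pi.zero_apply, sub_zero, hC_lap,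
        Sum.inr.injEq]
      simp

-- Within `V` the gluing changes only the degree of `v`, where `Γ` vanishes; hence the sums over `V`
-- in the numerators are those of `G`, and only the total degree sees the change.
open Classical in
theorem SimpleGraph.IsConeGluing.hasKemenyConstant [Nonempty W] [DecidableRel B.Adj]
    [DecidableEq W] (hH : G.IsConeGluing v B H)
    (hG : G.Connected) {Γ : V → V → ℝ} (hΓ : G.IsGreenKernel v Γ) {d : W → ℝ}
    (hB : ∀ w, (B.degree w : ℝ) = d w) {C : W → W → ℝ} (hC : ∀ u w, C u w = C w u)
    (hC_lap : ∀ w u, d u * C u w - (∑ a, if B.Adj u a then C a w else 0) + C u w =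
      if u = w then 1 else 0) :
    H.HasKemenyConstant (∑ j, G.degree j * Γ j j + ∑ w, (1 + d w) * C w w -
      (∑ i, G.degree i * ∑ j, G.degree j * Γ i j +
        ∑ u, (1 + d u) * ∑ w, (1 + d w) * C u w) /
      (∑ i, (G.degree i : ℝ) + Fintype.card W + ∑ w, (1 + d w))) := by
  have hdeg : ∀ w, (H.degree (Sum.inr w) : ℝ) = 1 + d w := fun w => by
    rw [hH.degree_inr, ← hB w]
    congr!
  have hC_lap' : ∀ w u, B.laplacian (fun a => C a w) u + C u w = if u = w then 1 else 0 := by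
    intro w u
    rw [laplacian_apply, ← hC_lap w u, ← hB u]
    congr!
  have hd : ∀ a, 0 < H.degree a := by
    rintro (i | w)
    · rw [← Nat.cast_pos (α := ℝ), hH.degree_inl]
      by_cases hi : i = v
      · rw [if_pos hi]
        have : (0 : ℝ) < Fintype.card W := Nat.cast_pos.2 Fintype.card_pos
        positivity
      · have : Nontrivial V := ⟨i, v, hi⟩
        rw [if_neg hi, mul_zero, add_zero, Nat.cast_pos]
        exact hG.preconnected.degree_pos_of_nontrivial i
    · rw [← Nat.cast_pos (α := ℝ), hdeg, ← hB]
      positivity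
  have hK := (hH.isGreenKernel hΓ hC fun w u => by convert hC_lap' w u).hasKemenyConstant hd
  have hv : ∀ i, (∑ j, ((G.degree j : ℝ) + Fintype.card W * if j = v then 1 else 0) * Γ i j) =
      ∑ j, G.degree j * Γ i j := fun i => Finset.sum_congr rfl fun j _ => by
    split_ifs with hj
    · rw [hj, hΓ.symm, hΓ.ground, mul_zero, mul_zero]
    · simp
  have hvv : (∑ j, ((G.degree j : ℝ) + Fintype.card W * if j = v then 1 else 0) * Γ j j) =
      ∑ j, G.degree j * Γ j j := Finset.sum_congr rfl fun j _ => by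
    split_ifs with hj
    · rw [hj, hΓ.ground, mul_zero, mul_zero]
    · simp
  have hss : (∑ i, ((G.degree i : ℝ) + Fintype.card W * if i = v then 1 else 0) *
      ∑ j, G.degree j * Γ i j) = ∑ i, G.degree i * ∑ j, G.degree j * Γ i j :=
    Finset.sum_congr rfl fun i _ => by
      split_ifs with hi
      · simp [hi, hΓ.ground]
      · simp
  simp only [Fintype.sum_sum_type, hH.degree_inl, hdeg, Sum.elim_inl, Sum.elim_inr,
    Pi.zero_apply, mul_zero, Finset.sum_const_zero, add_zero, zero_add, hv, hvv, hss] at hK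
  rw [Finset.sum_add_distrib, ← Finset.mul_sum, Finset.sum_ite_eq' Finset.univ v] at hK
  simpa using hK

end ConeGluing

/-! ### The two pendant configurations -/

section Pendants

variable {V : Type*} (G : SimpleGraph V) (v : V)

theorem SimpleGraph.isConeGluing_pendantTriplet :
    G.IsConeGluing v (⊥ : SimpleGraph (Fin 3)) (G.pendantTriplet v) where
  inl_inl i j := by simp [pendantTriplet]
  inl_inr i w := by simp [pendantTriplet, eq_comm]
  inr_inr u w := by simp [pendantTriplet]

theorem SimpleGraph.IsConeGluing.sup_edge {V W : Type*} {G : SimpleGraph V} {v : V}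
    {B : SimpleGraph W} {H : SimpleGraph (V ⊕ W)} (hH : G.IsConeGluing v B H) (a b : W) :
    G.IsConeGluing v (B ⊔ SimpleGraph.edge a b)
      (H ⊔ SimpleGraph.edge (Sum.inr a) (Sum.inr b)) where
  inl_inl i j := by simp [edge_adj, hH.inl_inl]
  inl_inr i w := by simp [edge_adj, hH.inl_inr]
  inr_inr u w := by simp [edge_adj, hH.inr_inr]

theorem SimpleGraph.isConeGluing_pendantTripletOne :
    G.IsConeGluing v (⊥ ⊔ SimpleGraph.edge (0 : Fin 3) 1) (G.pendantTripletOne v) :=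
  (G.isConeGluing_pendantTriplet v).sup_edge 0 1

theorem SimpleGraph.isConeGluing_pendantTripletTwo :
    G.IsConeGluing v (⊥ ⊔ SimpleGraph.edge (0 : Fin 3) 1 ⊔ SimpleGraph.edge 1 2)
      (G.pendantTripletTwo v) :=
  (G.isConeGluing_pendantTripletOne v).sup_edge 1 2

variable {G v}

open Classical in
theorem SimpleGraph.hasKemenyConstant_pendantTripletOne [Fintype V] (hG : G.Connected)
    {Γ : V → V → ℝ} (hΓ : G.IsGreenKernel v Γ) :
    (G.pendantTripletOne v).HasKemenyConstant (∑ j, G.degree j * Γ j j + 11 / 3 -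
      (∑ i, G.degree i * ∑ j, G.degree j * Γ i j + 9) / (∑ i, (G.degree i : ℝ) + 8)) := by
  -- `C` is `(L_B + 1)⁻¹` for an edge plus an isolated vertex.
  have h := (G.isConeGluing_pendantTripletOne v).hasKemenyConstant hG hΓ
    (d := ![1, 1, 0]) (C := ![![2 / 3, 1 / 3, 0], ![1 / 3, 2 / 3, 0], ![0, 0, 1]])
    (fun w => by
      rw [degree_eq_sum_if_adj, Fin.sum_univ_three]
      fin_cases w <;> simp [edge_adj])
    (fun u w => by fin_cases u <;> fin_cases w <;> rfl)
    (fun w u => by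
      rw [Fin.sum_univ_three]
      fin_cases u <;> fin_cases w <;> simp [edge_adj] <;> norm_num)
  simp only [Fin.sum_univ_three] at h
  convert h using 1
  simp
  congr 1
  · norm_num
  · congr 1 <;> ring

open Classical in
theorem SimpleGraph.hasKemenyConstant_pendantTripletTwo [Fintype V] (hG : G.Connected)
    {Γ : V → V → ℝ} (hΓ : G.IsGreenKernel v Γ) :
    (G.pendantTripletTwo v).HasKemenyConstant (∑ j, G.degree j * Γ j j + 4 -
      (∑ i, G.degree i * ∑ j, G.degree j * Γ i j + 33 / 2) / (∑ i, (G.degree i : ℝ) + 10)) := by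
  -- `C` is `(L_B + 1)⁻¹` for the path on three vertices.
  have h := (G.isConeGluing_pendantTripletTwo v).hasKemenyConstant hG hΓ
    (d := ![1, 2, 1]) (C := ![![5 / 8, 1 / 4, 1 / 8], ![1 / 4, 1 / 2, 1 / 4], ![1 / 8, 1 / 4, 5 / 8]])
    (fun w => by
      rw [degree_eq_sum_if_adj, Fin.sum_univ_three]
      fin_cases w <;> simp [edge_adj] <;> norm_num)
    (fun u w => by fin_cases u <;> fin_cases w <;> rfl)
    (fun w u => by
      rw [Fin.sum_univ_three]
      fin_cases u <;> fin_cases w <;> simp [edge_adj] <;> norm_num)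
  simp only [Fin.sum_univ_three] at h
  convert h using 1
  simp
  congr 1
  · norm_num
  · congr 1 <;> ring

end Pendants

/-! ### Bounding the degree-weighted hitting times of `v` -/

theorem SimpleGraph.cast_ncard_edgeSet {V : Type*} [Fintype V] (G : SimpleGraph V)
    [DecidableRel G.Adj] : 2 * (G.edgeSet.ncard : ℝ) = ∑ i, (G.degree i : ℝ) := by
  classical
  rw [← coe_edgeFinset, Set.ncard_coe_finset]
  exact_mod_cast G.sum_degrees_eq_twice_card_edges.symm

open Classical in
/-- The degree-weighted total of the mean hitting times of `v` is at least the number of edges. -/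
theorem SimpleGraph.IsGreenKernel.ncard_edgeSet_le {V : Type*} [Fintype V] {G : SimpleGraph V}
    {v : V} {Γ : V → V → ℝ} (hΓ : G.IsGreenKernel v Γ) (hG : G.Connected) :
    (G.edgeSet.ncard : ℝ) ≤ ∑ i, G.degree i * ∑ j, G.degree j * Γ i j := by
  set x : V → ℝ := fun i => ∑ j, G.degree j * Γ i j with hx
  have hxv : x v = 0 := by simp [hx, hΓ.ground]
  have hlap : ∀ i, i ≠ v → G.laplacian x i = G.degree i := fun i hi => by
    rw [hx, hΓ.laplacian_sum fun k => (G.degree k : ℝ), if_neg hi, mul_zero, sub_zero]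
  have hx₀ : ∀ i, 0 ≤ x i := G.nonneg_of_laplacian_pos hxv fun i hi => by
    have : Nontrivial V := ⟨i, v, hi⟩
    rw [hlap i hi, Nat.cast_pos]
    exact hG.preconnected.degree_pos_of_nontrivial i
  -- Off `v`, `deg i * x i` is `deg i` plus a sum of nonnegative values of `x`, so `x i ≥ 1` in
  -- weighted form.
  have hx₁ : ∀ i, (G.degree i : ℝ) - (if i = v then (G.degree v : ℝ) else 0) ≤
      G.degree i * x i := fun i => by
    split_ifs with hi
    · rw [hi, hxv, sub_self, mul_zero]
    · have h := hlap i hi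
      rw [laplacian_apply] at h
      have : 0 ≤ ∑ k, if G.Adj i k then x k else 0 := Finset.sum_nonneg fun k _ => by
        split_ifs
        exacts [hx₀ k, le_rfl]
      linarith
  have hv : (G.degree v : ℝ) ≤ G.edgeSet.ncard := by
    rw [← coe_edgeFinset, Set.ncard_coe_finset, Nat.cast_le]
    exact G.degree_le_card_edgeFinset v
  have hsum := Finset.sum_le_sum fun i (_ : i ∈ Finset.univ) => hx₁ i
  rw [Finset.sum_sub_distrib, ← cast_ncard_edgeSet, Finset.sum_ite_eq' Finset.univ v,
    if_pos (Finset.mem_univ v)] at hsum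
  linarith

-- Every leaf reaches the centre in exactly one step, so the lower bound of `ncard_edgeSet_le` is
-- attained.
open Classical in
theorem SimpleGraph.IsGreenKernel.sum_degree_starGraph {V : Type*} [Fintype V] {G : SimpleGraph V}
    {v : V} {Γ : V → V → ℝ} (hΓ : G.IsGreenKernel v Γ) (hG : G = starGraph v) :
    ∑ i, G.degree i * ∑ j, G.degree j * Γ i j =
      (Fintype.card V : ℝ) - 1 := by
  set x : V → ℝ := fun i => ∑ j, G.degree j * Γ i j with hx
  have hxv : x v = 0 := by simp [hx, hΓ.ground]
  have hterm : ∀ i, G.degree i * x i = 1 - if i = v then (1 : ℝ) else 0 := fun i => by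
    by_cases hi : i = v
    · simp [hi, hxv]
    · have hlap : G.laplacian x i = G.degree i := by
        rw [hx, hΓ.laplacian_sum fun k => (G.degree k : ℝ), if_neg hi, mul_zero, sub_zero]
      have hadj : ∀ k, G.Adj i k ↔ k = v := fun k => by
        rw [hG, starGraph_adj]
        exact ⟨fun h => h.2.resolve_left hi, fun h => ⟨h ▸ hi, Or.inr h⟩⟩
      have hdeg : (G.degree i : ℝ) = 1 := by
        rw [← sum_adj_eq_degree]
        simp [hadj]
      simp only [laplacian_apply, hdeg, hadj, Finset.sum_ite_eq', Finset.mem_univ, if_true, hxv,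
        one_mul, sub_zero] at hlap
      rw [hdeg, hlap, if_neg hi, sub_zero, one_mul]
  rw [Finset.sum_congr rfl fun i _ => hterm i]
  simp [Finset.sum_sub_distrib]

/-! ### Comparison of the two constants -/

theorem mainTheorem10 :
    (∀ {V : Type*} [Fintype V] (G : SimpleGraph V) (v : V), G.Connected →
      4 ≤ G.edgeSet.ncard →
      ∃ κTilde κHat : ℝ, (G.pendantTripletOne v).HasKemenyConstant κTilde ∧
        (G.pendantTripletTwo v).HasKemenyConstant κHat ∧ κHat > κTilde) ∧
    ∃ (G : SimpleGraph (Fin 4)) (v : Fin 4), G.Connected ∧ G.edgeSet.ncard = 3 ∧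
      G = SimpleGraph.starGraph v ∧
      ∃ κTilde κHat : ℝ, (G.pendantTripletOne v).HasKemenyConstant κTilde ∧
        (G.pendantTripletTwo v).HasKemenyConstant κHat ∧ κHat < κTilde := by
  constructor
  · classical
    intro V _ G v hG hm
    obtain ⟨Γ, hΓ⟩ := hG.exists_isGreenKernel v
    refine ⟨_, _, SimpleGraph.hasKemenyConstant_pendantTripletOne hG hΓ,
      SimpleGraph.hasKemenyConstant_pendantTripletTwo hG hΓ, ?_⟩
    have hs := hΓ.ncard_edgeSet_le hG
    have hm' : (4 : ℝ) ≤ G.edgeSet.ncard := by exact_mod_cast hm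
    rw [← SimpleGraph.cast_ncard_edgeSet]
    generalize (G.edgeSet.ncard : ℝ) = m at *
    generalize ∑ i, (G.degree i : ℝ) * ∑ j, (G.degree j : ℝ) * Γ i j = s at *
    have hfrac : (s + 33 / 2) / (2 * m + 10) < 1 / 3 + (s + 9) / (2 * m + 8) := by
      rw [← sub_pos]
      have hnum : 1 / 3 + (s + 9) / (2 * m + 8) - (s + 33 / 2) / (2 * m + 10) =
          (2 / 3 * (m + 4) * (m + 5) + s - 15 / 2 * m - 21) / (2 * (m + 4) * (m + 5)) := by
        field_simp
        ring
      rw [hnum]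
      -- With `s ≥ m` the numerator is at least `2/3 m² - m/2 - 23/3`, which equals 1 at `m = 4` and
      -- increases from there.
      exact div_pos (by nlinarith) (by positivity)
    linarith
  · have hG := SimpleGraph.connected_starGraph (0 : Fin 4)
    have hm : (SimpleGraph.starGraph (0 : Fin 4)).edgeSet.ncard = 3 := by
      rw [← SimpleGraph.coe_edgeFinset, Set.ncard_coe_finset]
      decide
    obtain ⟨G, hstar⟩ : ∃ G, G = SimpleGraph.starGraph (0 : Fin 4) := ⟨_, rfl⟩
    rw [← hstar] at hG hm
    obtain ⟨Γ, hΓ⟩ := hG.exists_isGreenKernel 0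
    refine ⟨G, 0, hG, hm, hstar, _, _, SimpleGraph.hasKemenyConstant_pendantTripletOne hG hΓ,
      SimpleGraph.hasKemenyConstant_pendantTripletTwo hG hΓ, ?_⟩
    -- Here `s = m = 3`, for which the same numerator is `-19/6`.
    rw [hΓ.sum_degree_starGraph hstar, ← SimpleGraph.cast_ncard_edgeSet, hm, Fintype.card_fin]
    norm_num
    linarith
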